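/- Let $H$ and $F$ be finite simple graphs, where $H$ has at least one vertex. For a graph $G$, let $\mathcal N(H,G)$ be the number of (not necessarily induced) subgraphs of $G$ that are isomorphic to $H$. For $n\ge 0$ let $$\mathrm{rex}(n,H,F)=\max\{\mathcal N(H,G): G \text{ is an } F\text{-free regular graph on } n \text{ vertices}\},$$ where $F$-free means that $G$ has no (not necessarily induced) subgraph isomorphic to $F$, and where the maximum is $0$ if there is no such $G$. A blow-up of $H$ is a graph obtained by replacing each vertex of $H$ by a non-empty finite independent set and each edge of $H$ by a complete bipartite graph between the corresponding sets. Then $\mathrm{rex}(n,H,F)=\Theta(n^{|V(H)|})$ as $n\to\infty$ if and only if $F$ is not a subgraph of any blow-up of $H$. -/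

import Mathlib

open Filter Asymptotics

namespace RegularTuran

/-- The blow-up of `H` in which every vertex `v` is replaced by an independent set of `m v`
vertices and every edge `uv` by a complete bipartite graph between the sets of `u` and `v`. -/
def blowup {V : Type*} (H : SimpleGraph V) (m : V → ℕ) : SimpleGraph (Σ v : V, Fin (m v)) where
  Adj x y := H.Adj x.1 y.1
  symm := ⟨fun _ _ h => H.adj_symm h⟩
  loopless := ⟨fun _ h => H.irrefl h⟩

/-- `F` is a (not necessarily induced) subgraph of some blow-up of `H`, where every vertex of `H`
is replaced by a non-empty set. -/
def IsSubgraphOfBlowup {W V : Type*} (F : SimpleGraph W) (H : SimpleGraph V) : Prop :=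
  ∃ m : V → ℕ, (∀ v, 0 < m v) ∧ F.IsContained (blowup H m)

open Classical in
/-- `rex n H F` is the largest number of (unlabelled, not necessarily induced) copies of `H` in an
`F`-free regular graph on `n` vertices; it is `0` if there is no such graph. -/
noncomputable def rex {V W : Type*} (n : ℕ) (H : SimpleGraph V) (F : SimpleGraph W) : ℕ :=
  (Finset.univ.filter fun G : SimpleGraph (Fin n) =>
    F.Free G ∧ ∃ d : ℕ, G.IsRegularOfDegree d).sup fun G => G.copyCount H

end RegularTuran

namespace RegularTuran

/-! `F` lies in a blow-up of `H` exactly when there is a homomorphism `F →g H`. If there is one,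
`exists_box_of_dense` finds a large blow-up of `H`, hence `F`, in any graph with at least `c * n ^
|V|` copies of `H`. If there is none and `H` has an edge, blow up `regularExtension H`, a regular
graph that contains `H` and maps to `H`. The remaining vertices carry a circulant graph of the same
degree with jumps near `m / 2`; its short closed walks are even, so the part of `F` mapped into it
is bipartite and folds onto an edge of `H`. Thus a copy of `F` in the union would yield `F →g H`. -/

/-! ### Boxes in dense sets of tuples -/

/-- The `k`-partite hypergraph version of the Kővári–Sós–Turán theorem: a dense set of `k`-tuples
contains a box with sides of any prescribed size. -/
theorem exists_box_of_dense (k t : ℕ) {c : ℝ} (hc : 0 < c) :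
    ∃ N : ℕ, ∀ n ≥ N, ∀ S : Finset (Fin k → Fin n), c * (n : ℝ) ^ k ≤ S.card →
      ∃ A : Fin k → (Fin (t + 1) ↪ Fin n),
        ∀ f : Fin k → Fin (t + 1), (fun i => A i (f i)) ∈ S := by
  classical
  induction k generalizing c with
  | zero =>
    refine ⟨0, fun n _ S hS => ⟨fun i => i.elim0, fun f => ?_⟩⟩
    have hpos : (0 : ℝ) < S.card := by
      refine lt_of_lt_of_le ?_ hS
      simpa using hc
    obtain ⟨g, hg⟩ := Finset.card_pos.1 (by exact_mod_cast hpos)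
    rwa [Subsingleton.elim (fun i : Fin 0 => _) g]
  | succ k ih =>
    -- The density left for the last `k` coordinates once a popular `a` is fixed as first side; half
    -- of `c` pays for the `t` subtracted from each fibre size.
    obtain ⟨N, hN⟩ := ih (c := (c / 2) ^ (t + 1)) (by positivity)
    refine ⟨max (max N 1) ⌈2 * (t + 1) / c⌉₊, fun n hn S hS => ?_⟩
    have hnN : N ≤ n := by omega
    have hn1 : 1 ≤ n := by omega
    have hnpos : (0 : ℝ) < n := by exact_mod_cast hn1
    have hnt : 2 * ((t : ℝ) + 1) ≤ c * n := by
      have : 2 * ((t : ℝ) + 1) / c ≤ n :=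
        (Nat.le_ceil _).trans (by exact_mod_cast (le_max_right _ _).trans hn)
      rw [div_le_iff₀ hc] at this
      linarith
    let D : (Fin k → Fin n) → Finset (Fin n) :=
      fun g => Finset.univ.filter fun x => (Fin.cons x g : Fin (k + 1) → Fin n) ∈ S
    have hD : ∑ g, (D g).card = S.card := by
      have hS' : S.card = ((Finset.univ : Finset ((Fin k → Fin n) × Fin n)).filter
          fun p => (Fin.cons p.2 p.1 : Fin (k + 1) → Fin n) ∈ S).card := by
        refine Finset.card_bij' (fun f _ => (Fin.tail f, f 0)) (fun p _ => Fin.cons p.2 p.1)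
          ?_ ?_ ?_ ?_ <;> simp [Fin.cons_self_tail]
      rw [hS', Finset.card_filter, Fintype.sum_prod_type]
      exact Finset.sum_congr rfl fun g _ => Finset.card_filter _ _
    let R : (Fin k → Fin n) → (Fin (t + 1) ↪ Fin n) → Prop := fun g a => ∀ i, a i ∈ D g
    have hcount := Finset.sum_card_bipartiteAbove_eq_sum_card_bipartiteBelow
      (s := Finset.univ) (t := Finset.univ) R
    have habove : ∀ g, ((D g).card - t) ^ (t + 1) ≤
        (Finset.bipartiteAbove R Finset.univ g).card := by
      intro g
      have h1 : ((D g).card - t) ^ (t + 1) ≤ (D g).card.descFactorial (t + 1) := by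
        have := Nat.pow_sub_le_descFactorial (D g).card (t + 1)
        rwa [Nat.add_sub_add_right] at this
      refine h1.trans ?_
      have h2 : Fintype.card (Fin (t + 1) ↪ D g) = (D g).card.descFactorial (t + 1) := by
        rw [Fintype.card_embedding_eq]; simp
      rw [← h2, ← Finset.card_univ]
      refine Finset.card_le_card_of_injOn (fun a => a.trans (Function.Embedding.subtype _)) ?_ ?_
      · intro a _
        simp [Finset.bipartiteAbove, R]
      · intro a _ b _ hab
        ext i
        simpa using congrArg (fun e : Fin (t + 1) ↪ Fin n => (e i : ℕ)) hab
    have hsum : ((c / 2) ^ (t + 1) * (n : ℝ) ^ k) * (n : ℝ) ^ (t + 1) ≤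
        ((∑ g, (Finset.bipartiteAbove R Finset.univ g).card : ℕ) : ℝ) := by
      have hlow : c / 2 * (n : ℝ) ^ (k + 1) ≤ ∑ g, (((D g).card - t : ℕ) : ℝ) := by
        have h3 : (S.card : ℝ) - t * (n : ℝ) ^ k ≤ ∑ g, (((D g).card - t : ℕ) : ℝ) := by
          have h4 : ∑ g : Fin k → Fin n, (((D g).card : ℝ) - t) = S.card - t * (n : ℝ) ^ k := by
            rw [Finset.sum_sub_distrib, ← hD]
            simp [mul_comm]
          rw [← h4]
          refine Finset.sum_le_sum fun g _ => ?_
          have : (D g).card ≤ ((D g).card - t) + t := by omega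
          have : ((D g).card : ℝ) ≤ (((D g).card - t : ℕ) : ℝ) + t := by exact_mod_cast this
          linarith
        have h5 : (t : ℝ) * (n : ℝ) ^ k ≤ c / 2 * (n : ℝ) ^ (k + 1) := by
          rw [pow_succ, mul_comm ((n : ℝ) ^ k), ← mul_assoc]
          gcongr
          linarith
        linarith
      -- Power mean inequality over the fibres `D g`.
      have hjen := pow_sum_div_card_le_sum_pow (s := Finset.univ)
        (f := fun g : Fin k → Fin n => (((D g).card - t : ℕ) : ℝ)) (fun _ _ => by positivity) t
      have hcard : (((Finset.univ : Finset (Fin k → Fin n)).card : ℕ) : ℝ) = (n : ℝ) ^ k := by simp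
      rw [hcard] at hjen
      calc ((c / 2) ^ (t + 1) * (n : ℝ) ^ k) * (n : ℝ) ^ (t + 1)
          = (c / 2 * (n : ℝ) ^ (k + 1)) ^ (t + 1) / ((n : ℝ) ^ k) ^ t := by
            field_simp
            ring
        _ ≤ (∑ g, (((D g).card - t : ℕ) : ℝ)) ^ (t + 1) / ((n : ℝ) ^ k) ^ t := by gcongr
        _ ≤ _ := hjen
        _ ≤ _ := by
          push_cast
          refine Finset.sum_le_sum fun g _ => ?_
          exact_mod_cast habove g
    obtain ⟨a, ha⟩ : ∃ a : Fin (t + 1) ↪ Fin n, (c / 2) ^ (t + 1) * (n : ℝ) ^ k ≤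
        (Finset.bipartiteBelow R Finset.univ a).card := by
      by_contra! hcon
      rw [hcount] at hsum
      push_cast at hsum
      have hpos : 0 < (c / 2) ^ (t + 1) * (n : ℝ) ^ k * (n : ℝ) ^ (t + 1) := by positivity
      have hne : (Finset.univ : Finset (Fin (t + 1) ↪ Fin n)).Nonempty := by
        by_contra hemp
        rw [Finset.not_nonempty_iff_eq_empty] at hemp
        rw [hemp] at hsum
        simp only [Finset.sum_empty] at hsum
        linarith
      have hlt := hsum.trans_lt (Finset.sum_lt_sum_of_nonempty hne fun a _ => hcon a)
      have hle : (Fintype.card (Fin (t + 1) ↪ Fin n) : ℝ) ≤ (n : ℝ) ^ (t + 1) := by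
        rw [Fintype.card_embedding_eq]
        exact_mod_cast (Nat.descFactorial_le_pow _ _).trans (by simp)
      rw [Finset.sum_const, nsmul_eq_mul, Finset.card_univ, mul_comm] at hlt
      exact absurd hlt (not_lt.2 (by gcongr))
    obtain ⟨A, hA⟩ := hN n hnN _ ha
    refine ⟨Fin.cons a A, fun f => ?_⟩
    have h6 := hA (Fin.tail f)
    simp only [Finset.bipartiteBelow, Finset.mem_filter, Finset.mem_univ, true_and, R, D] at h6
    convert h6 (f 0) using 1
    funext i
    refine Fin.cases ?_ (fun j => ?_) i <;> simp [Fin.tail]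

/-! ### Many copies of `H` force `F`; upper bound -/

theorem labelledCopyCount_eq_natCard {V U : Type*} [Fintype V] [Fintype U] (G : SimpleGraph U)
    (H : SimpleGraph V) : G.labelledCopyCount H = Nat.card (H.Copy G) := by
  rw [SimpleGraph.labelledCopyCount, Fintype.card_eq_nat_card]

theorem isContained_of_hom_of_many_copies {V W : Type*} [Fintype V] [Fintype W]
    {H : SimpleGraph V} {F : SimpleGraph W} (h : F →g H) {c : ℝ} (hc : 0 < c) :
    ∃ N : ℕ, ∀ n ≥ N, ∀ G : SimpleGraph (Fin n),
      c * (n : ℝ) ^ Fintype.card V ≤ G.copyCount H → F.IsContained G := by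
  classical
  obtain ⟨N, hN⟩ := exists_box_of_dense (Fintype.card V) (Fintype.card W) hc
  refine ⟨N, fun n hn G hG => ?_⟩
  let e := Fintype.equivFin V
  let e' : W ↪ Fin (Fintype.card W + 1) := (Fintype.equivFin W).toEmbedding.trans Fin.castSuccEmb
  let S : Finset (Fin (Fintype.card V) → Fin n) := Finset.univ.filter fun f =>
    Function.Injective f ∧ ∀ u v, H.Adj u v → G.Adj (f (e u)) (f (e v))
  have hS : G.copyCount H ≤ S.card := by
    refine SimpleGraph.copyCount_le_labelledCopyCount.trans ?_
    rw [labelledCopyCount_eq_natCard, ← Nat.card_eq_finsetCard]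
    refine Nat.card_le_card_of_injective (fun φ => ⟨fun i => φ (e.symm i), ?_⟩) ?_
    · simp only [S, Finset.mem_filter, Finset.mem_univ, true_and, Equiv.symm_apply_apply]
      exact ⟨φ.injective.comp e.symm.injective, fun u v huv => φ.toHom.map_adj huv⟩
    · intro φ ψ hφ
      ext v
      simpa using congrArg Fin.val (congrFun (congrArg Subtype.val hφ) (e v))
  obtain ⟨A, hA⟩ := hN n hn S (hG.trans (by exact_mod_cast hS))
  have key : ∀ w w', h w ≠ h w' → A (e (h w)) (e' w) ≠ A (e (h w')) (e' w') ∧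
      (H.Adj (h w) (h w') → G.Adj (A (e (h w)) (e' w)) (A (e (h w')) (e' w'))) := by
    intro w w' hne
    have hne' : e (h w) ≠ e (h w') := e.injective.ne hne
    -- A point of the box with prescribed entries in the two coordinates that matter.
    have := hA (Function.update (fun _ => e' w) (e (h w')) (e' w'))
    simp only [S, Finset.mem_filter, Finset.mem_univ, true_and] at this
    obtain ⟨hinj, hadj⟩ := this
    refine ⟨?_, fun hh => ?_⟩
    · simpa [Function.update_of_ne hne'] using hinj.ne hne'
    · simpa [Function.update_of_ne hne'] using hadj _ _ hh
  refine ⟨⟨⟨fun w => A (e (h w)) (e' w), fun {w w'} hw => ?_⟩, fun w w' hw => ?_⟩⟩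
  · have hadj := h.map_adj hw
    exact (key w w' hadj.ne).2 hadj
  · by_contra hne
    by_cases hh : h w = h w'
    · change A (e (h w)) (e' w) = A (e (h w')) (e' w') at hw
      rw [hh] at hw
      exact hne (e'.injective ((A _).injective hw))
    · exact (key w w' hh).1 hw

theorem isSubgraphOfBlowup_iff_nonempty_hom {V W : Type*} [Fintype W]
    {H : SimpleGraph V} {F : SimpleGraph W} :
    IsSubgraphOfBlowup F H ↔ Nonempty (F →g H) := by
  refine ⟨fun ⟨m, _, ⟨φ⟩⟩ => ⟨⟨fun w => (φ w).1, fun hw => φ.toHom.map_adj hw⟩⟩, fun ⟨h⟩ => ?_⟩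
  -- The `+ 1` keeps the classes non-empty when `W` is empty.
  refine ⟨fun _ => Fintype.card W + 1, fun _ => Nat.succ_pos _,
    ⟨⟨⟨fun w => ⟨h w, (Fintype.equivFin W w).castSucc⟩, fun hw => h.map_adj hw⟩, ?_⟩⟩⟩
  intro w w' hw
  have h2 : ((Fintype.equivFin W w : ℕ)) = Fintype.equivFin W w' :=
    congrArg (fun p : Σ _ : V, Fin (Fintype.card W + 1) => (p.2 : ℕ)) hw
  exact (Fintype.equivFin W).injective (Fin.ext h2)

theorem rex_le_pow {V W : Type*} [Fintype V] (n : ℕ) (H : SimpleGraph V) (F : SimpleGraph W) :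
    rex n H F ≤ n ^ Fintype.card V := by
  classical
  refine Finset.sup_le fun G _ => SimpleGraph.copyCount_le_labelledCopyCount.trans ?_
  rw [labelledCopyCount_eq_natCard]
  refine (Nat.card_le_card_of_injective (fun φ : SimpleGraph.Copy H G => (φ : V → Fin n))
    DFunLike.coe_injective).trans ?_
  simp

/-! ### Circulant graphs without short odd closed walks -/

/-- Colour by parity of the distance to a root of the component. A monochromatic edge closes two
shortest paths, each of length below `|W|`, into a short odd closed walk. -/
theorem colorable_two_of_forall_short_loop_even {W : Type*} [Fintype W] {K : SimpleGraph W}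
    (hK : ∀ u (p : K.Walk u u), p.length ≤ 2 * Fintype.card W → Even p.length) :
    K.Colorable 2 := by
  have hr : ∀ v, K.Reachable (K.connectedComponentMk v).out v := fun v =>
    SimpleGraph.ConnectedComponent.exact (Quot.out_eq (K.connectedComponentMk v))
  refine ⟨SimpleGraph.Coloring.mk
    (fun v => (Fin.ofNat 2 (K.dist (K.connectedComponentMk v).out v))) ?_⟩
  intro u v huv heq
  obtain ⟨p, hp, hpl⟩ := (hr u).exists_path_of_dist
  obtain ⟨q, hq, hql⟩ := (hr v).exists_path_of_dist
  have hc : K.connectedComponentMk u = K.connectedComponentMk v :=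
    SimpleGraph.ConnectedComponent.sound huv.reachable
  have heq' := congrArg Fin.val heq
  simp only [Fin.ofNat, ← hpl, ← hql] at heq'
  clear hpl hql heq
  revert p
  rw [hc]
  intro p hp heq'
  have hlen := hp.length_lt
  have hlen' := hq.length_lt
  have := hK _ ((p.concat huv).append q.reverse) (by simp; omega)
  simp only [SimpleGraph.Walk.length_append, SimpleGraph.Walk.length_concat,
    SimpleGraph.Walk.length_reverse, Nat.even_iff] at this
  omega

/-- The jumps `x ≠ m / 2` of `ZMod m` at distance at most `k` from `m / 2`. -/
def middleJumps (m k : ℕ) : Set (ZMod m) :=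
  {x | 2 * x.val ≠ m ∧ m ≤ 2 * x.val + 2 * k ∧ 2 * x.val ≤ m + 2 * k}

/-- Leaving out `m / 2` makes the count the same for both parities of `m`. -/
theorem ncard_middleJumps {m k : ℕ} (hk : 2 * k < m) : (middleJumps m k).ncard = 2 * k := by
  have : NeZero m := ⟨by omega⟩
  have himg : ZMod.val '' middleJumps m k =
      ((Finset.Icc ((m + 1) / 2 - k) (m / 2 + k)).filter fun v => 2 * v ≠ m : Finset ℕ) := by
    ext v
    simp only [middleJumps, Set.mem_image, Set.mem_ofPred_eq, Finset.coe_filter, Finset.mem_Icc]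
    constructor
    · rintro ⟨x, hx, rfl⟩
      omega
    · intro hv
      have : (v : ZMod m).val = v := ZMod.val_cast_of_lt (by omega)
      exact ⟨v, by rw [this]; omega, this⟩
  rw [← Set.ncard_image_of_injective _ (ZMod.val_injective m), himg, Set.ncard_coe_finset]
  rcases Nat.even_or_odd' m with ⟨h, rfl | rfl⟩
  · have : ((Finset.Icc ((2 * h + 1) / 2 - k) (2 * h / 2 + k)).filter fun v => 2 * v ≠ 2 * h) =
        (Finset.Icc (h - k) (h + k)).erase h := by
      ext v
      simp only [Finset.mem_filter, Finset.mem_Icc, Finset.mem_erase]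
      omega
    rw [this, Finset.card_erase_of_mem (by simp), Nat.card_Icc]
    omega
  · rw [Finset.filter_true_of_mem (by intros; omega), Nat.card_Icc]
    omega

theorem neg_mem_middleJumps {m k : ℕ} (hk : 2 * k < m) {x : ZMod m} (hx : x ∈ middleJumps m k) :
    -x ∈ middleJumps m k := by
  have : NeZero m := ⟨by omega⟩
  have hx0 : x ≠ 0 := by
    rintro rfl
    simp [middleJumps] at hx
    omega
  have : NeZero x := ⟨hx0⟩
  have hlt := x.val_lt
  simp only [middleJumps, Set.mem_ofPred_eq, ZMod.val_neg_of_ne_zero] at hx ⊢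
  omega

theorem middleJumps_adj_iff {m k : ℕ} (hk : 2 * k < m) {x y : ZMod m} :
    (SimpleGraph.circulantGraph (middleJumps m k)).Adj x y ↔ y - x ∈ middleJumps m k := by
  have hneg : ∀ z : ZMod m, -z ∈ middleJumps m k → z ∈ middleJumps m k := fun z hz => by
    simpa using neg_mem_middleJumps hk hz
  rw [SimpleGraph.circulantGraph_adj]
  constructor
  · rintro ⟨_, h | h⟩
    · exact hneg _ (by simpa using h)
    · exact h
  · refine fun h => ⟨?_, Or.inr h⟩
    rintro rfl
    simp [middleJumps] at h
    omega

theorem ncard_neighborSet_middleJumps {m k : ℕ} (hk : 2 * k < m) (x : ZMod m) :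
    ((SimpleGraph.circulantGraph (middleJumps m k)).neighborSet x).ncard = 2 * k := by
  rw [← ncard_middleJumps hk, ← Set.ncard_image_of_injective (middleJumps m k)
    (add_right_injective x)]
  congr 1
  ext y
  simp only [SimpleGraph.mem_neighborSet, middleJumps_adj_iff hk, Set.mem_image]
  exact ⟨fun h => ⟨_, h, by simp⟩, by rintro ⟨z, hz, rfl⟩; simpa using hz⟩

/-- Each jump is `m / 2` up to an error of `k`, so a walk of length `l` lifts to an integer
displacement within `k * l` of `l * m / 2`. On a closed walk this is a multiple of `m`; for odd `l`
the gap is at least `m / 2`, which forces `l` to be large. -/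
theorem colorable_two_of_hom_middleJumps {W : Type*} [Fintype W] {K : SimpleGraph W} {m k : ℕ}
    (hm : 4 * k * (Fintype.card W + 1) < m)
    (f : K →g SimpleGraph.circulantGraph (middleJumps m k)) : K.Colorable 2 := by
  have hk : 2 * k < m := by nlinarith
  have : NeZero m := ⟨by omega⟩
  have hwalk : ∀ {u v} (p : K.Walk u v), ∃ z : ℤ, (z : ZMod m) = f v - f u ∧
      |2 * z - p.length * m| ≤ 2 * k * p.length := by
    intro u v p
    induction p with
    | nil => exact ⟨0, by simp⟩
    | @cons u v w huv p ih =>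
      obtain ⟨z, hz, hzl⟩ := ih
      have hs := (middleJumps_adj_iff hk).1 (f.map_adj huv)
      refine ⟨z + (f v - f u).val, ?_, ?_⟩
      · push_cast
        rw [hz, ZMod.natCast_zmod_val]
        ring
      · obtain ⟨-, h1, h2⟩ := hs
        zify at h1 h2
        rw [abs_le] at hzl ⊢
        simp only [SimpleGraph.Walk.length_cons]
        push_cast
        constructor <;> linarith
  refine colorable_two_of_forall_short_loop_even fun u p hp => ?_
  by_contra hodd
  rw [Nat.not_even_iff_odd] at hodd
  obtain ⟨l, hl⟩ := hodd
  obtain ⟨z, hz, hzl⟩ := hwalk p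
  rw [sub_self, ZMod.intCast_zmod_eq_zero_iff_dvd] at hz
  obtain ⟨q, rfl⟩ := hz
  have h1 : 2 * ((m : ℤ) * q) - p.length * m = (2 * q - p.length) * m := by ring
  have h2 : (1 : ℤ) ≤ |2 * q - p.length| := Int.one_le_abs (by omega)
  rw [h1, abs_mul, Nat.abs_cast] at hzl
  have h3 : (m : ℤ) ≤ 2 * k * p.length := by nlinarith
  have h4 : m ≤ 2 * k * p.length := by exact_mod_cast h3
  have h5 : 2 * k * p.length ≤ 2 * k * (2 * Fintype.card W) := by gcongr
  nlinarith

/-! ### The regular extension of `H` -/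

/-- A regular graph containing `H` and homomorphic to `H`, provided that `H` has an edge: it has a
copy of `H` for each `j : V`, and for each non-adjacent pair `(v, w)` a vertex that is joined to `v`
in every copy. -/
def regularExtension {V : Type*} (H : SimpleGraph V) :
    SimpleGraph ((V × V) ⊕ {p : V × V // ¬ H.Adj p.1 p.2}) where
  Adj
    | .inl x, .inl y => H.Adj x.1 y.1 ∧ x.2 = y.2
    | .inl x, .inr y => x.1 = y.1.1
    | .inr x, .inl y => y.1 = x.1.1
    | .inr _, .inr _ => False
  symm := ⟨by
    rintro (x | x) (y | y) h
    · exact ⟨h.1.symm, h.2.symm⟩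
    · exact h
    · exact h
    · exact h⟩
  loopless := ⟨by
    rintro (x | x) h
    · exact H.irrefl h.1
    · exact h⟩

theorem ncard_neighborSet_regularExtension {V : Type*} [Fintype V] (H : SimpleGraph V)
    (x : (V × V) ⊕ {p : V × V // ¬ H.Adj p.1 p.2}) :
    ((regularExtension H).neighborSet x).ncard = Fintype.card V := by
  classical
  rw [← Nat.card_eq_fintype_card, ← Set.ncard_univ]
  rcases x with ⟨v, j⟩ | ⟨⟨v, w⟩, hvw⟩
  · have hinj : Function.Injective fun w => if h : H.Adj v w then
        (Sum.inl (w, j) : (V × V) ⊕ {p : V × V // ¬ H.Adj p.1 p.2}) else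
        Sum.inr ⟨(v, w), h⟩ := by
      intro a b hab
      dsimp only at hab
      split_ifs at hab <;> simp_all
    rw [← Set.ncard_image_of_injective _ hinj]
    congr 1
    ext (⟨a, b⟩ | ⟨⟨a, b⟩, hab⟩)
    · simp only [SimpleGraph.mem_neighborSet, regularExtension, Set.image_univ, Set.mem_range]
      constructor
      · rintro ⟨h, rfl⟩
        exact ⟨a, dif_pos h⟩
      · rintro ⟨w, hw⟩
        split_ifs at hw
        simp_all
    · simp only [SimpleGraph.mem_neighborSet, regularExtension, Set.image_univ, Set.mem_range]
      constructor
      · rintro rfl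
        exact ⟨b, dif_neg hab⟩
      · rintro ⟨w, hw⟩
        split_ifs at hw
        simp_all
  · have hinj : Function.Injective fun j =>
        (Sum.inl (v, j) : (V × V) ⊕ {p : V × V // ¬ H.Adj p.1 p.2}) := by
      intro a b hab
      simpa using hab
    rw [← Set.ncard_image_of_injective _ hinj]
    congr 1
    ext (⟨a, b⟩ | ⟨⟨a, b⟩, hab⟩)
    · simp [SimpleGraph.mem_neighborSet, regularExtension, eq_comm]
    · simp [SimpleGraph.mem_neighborSet, regularExtension]

/-- Extra vertices go to a neighbour of the vertex they are attached to. Isolated vertices of `H`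
have none, so they are first moved to `a`. -/
theorem nonempty_hom_of_regularExtension {V : Type*} {H : SimpleGraph V} {a b : V}
    (hab : H.Adj a b) : Nonempty (regularExtension H →g H) := by
  classical
  let base : V → V := fun v => if ∃ u, H.Adj v u then v else a
  have hbase : ∀ v, ∃ u, H.Adj (base v) u := by
    intro v
    by_cases h : ∃ u, H.Adj v u
    · simpa only [base, if_pos h] using h
    · simpa only [base, if_neg h] using ⟨b, hab⟩
  choose nb hnb using hbase
  refine ⟨⟨Sum.elim (fun x => base x.1) (fun y => nb y.1.1), ?_⟩⟩
  rintro (x | x) (y | y) h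
  · have hx : base x.1 = x.1 := if_pos ⟨_, h.1⟩
    have hy : base y.1 = y.1 := if_pos ⟨_, h.1.symm⟩
    simpa only [Sum.elim_inl, hx, hy] using h.1
  · have h' : x.1 = y.1.1 := h
    simpa only [Sum.elim_inl, Sum.elim_inr, h'] using hnb _
  · have h' : y.1 = x.1.1 := h
    simpa only [Sum.elim_inl, Sum.elim_inr, h'] using (hnb _).symm
  · exact h.elim

/-! ### The lower bound construction -/

/-- Different choices of one vertex per class give different vertex sets, so the copies are distinct
even as unlabelled subgraphs. -/
theorem pow_le_copyCount {V U : Type*} [Fintype V] [Fintype U] {H : SimpleGraph V}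
    {G : SimpleGraph U} {s : ℕ}
    (φ : SimpleGraph.Copy (H.comap (Prod.fst : V × Fin s → V)) G) :
    s ^ Fintype.card V ≤ G.copyCount H := by
  classical
  let ψ : (V → Fin s) → SimpleGraph.Copy H G := fun f =>
    ⟨⟨fun v => φ (v, f v), fun h => φ.toHom.map_adj h⟩,
      fun u v h => congrArg Prod.fst (φ.injective h)⟩
  have hinj : Function.Injective fun f => (ψ f).toSubgraph := by
    intro f g hfg
    funext v
    have hv : φ (v, f v) ∈ (ψ g).toSubgraph.verts := by
      have hfg' : (ψ f).toSubgraph = (ψ g).toSubgraph := hfg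
      rw [← hfg']
      exact ⟨v, by simp, rfl⟩
    obtain ⟨u, -, hu⟩ := hv
    have := φ.injective hu
    simp only [Prod.mk.injEq] at this
    obtain ⟨rfl, h⟩ := this
    exact h.symm
  rw [SimpleGraph.copyCount_eq_card_image_copyToSubgraph]
  calc s ^ Fintype.card V = (Finset.univ : Finset (V → Fin s)).card := by simp
    _ ≤ _ := Finset.card_le_card_of_injOn (fun f => (ψ f).toSubgraph)
      (fun f _ => Finset.mem_coe.2 (Finset.mem_image_of_mem _ (Finset.mem_univ _))) hinj.injOn

theorem isRegularOfDegree_of_ncard {U : Type*} {G : SimpleGraph U} {_ : G.LocallyFinite} {d : ℕ}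
    (h : ∀ x, (G.neighborSet x).ncard = d) : G.IsRegularOfDegree d := fun x => by
  rw [← h x, ← SimpleGraph.card_neighborSet_eq_degree, ← Nat.card_coe_set_eq,
    Nat.card_eq_fintype_card]

theorem le_rex {V W U : Type*} [Fintype V] [Fintype U] {n d s : ℕ} (hn : Fintype.card U = n)
    {H : SimpleGraph V} {F : SimpleGraph W} {G : SimpleGraph U} (hF : F.Free G)
    (hd : ∀ x, (G.neighborSet x).ncard = d)
    (φ : SimpleGraph.Copy (H.comap (Prod.fst : V × Fin s → V)) G) :
    s ^ Fintype.card V ≤ rex n H F := by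
  classical
  let e : U ≃ Fin n := Fintype.equivFinOfCardEq hn
  let i : G ≃g G.map e.toEmbedding := SimpleGraph.Iso.map e G
  refine (pow_le_copyCount (i.toCopy.comp φ)).trans ?_
  refine Finset.le_sup (f := fun G : SimpleGraph (Fin n) => G.copyCount H) ?_
  simp only [Finset.mem_filter, Finset.mem_univ, true_and]
  refine ⟨(SimpleGraph.free_congr_right i).1 hF, d, isRegularOfDegree_of_ncard fun x => ?_⟩
  obtain ⟨y, rfl⟩ := i.surjective x
  rw [← hd y, ← Set.ncard_image_of_injective _ i.injective]
  congr 1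
  ext z
  obtain ⟨z, rfl⟩ := i.surjective z
  simpa [i.injective.eq_iff] using i.map_adj_iff

theorem ncard_neighborSet_comap_fst {X : Type*} [Finite X] (R : SimpleGraph X) (s : ℕ)
    (x : X × Fin s) : ((R.comap (Prod.fst : X × Fin s → X)).neighborSet x).ncard =
      (R.neighborSet x.1).ncard * s := by
  have : (R.comap (Prod.fst : X × Fin s → X)).neighborSet x =
      R.neighborSet x.1 ×ˢ Set.univ := by
    ext y
    simp
  rw [this, Set.ncard_prod, Set.ncard_univ, Nat.card_fin]

theorem ncard_neighborSet_sum {X Y : Type*} {G : SimpleGraph X} {K : SimpleGraph Y} {d : ℕ}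
    (hG : ∀ x, (G.neighborSet x).ncard = d) (hK : ∀ y, (K.neighborSet y).ncard = d) (z : X ⊕ Y) :
    ((G.sum K).neighborSet z).ncard = d := by
  rcases z with x | y
  · rw [← hG x, ← Set.ncard_image_of_injective (G.neighborSet x)
      (Sum.inl_injective (β := Y))]
    congr 1
    ext (a | a) <;> simp
  · rw [← hK y, ← Set.ncard_image_of_injective (K.neighborSet y)
      (Sum.inr_injective (α := X))]
    congr 1
    ext (a | a) <;> simp

theorem nonempty_hom_of_sum_middleJumps {V W X : Type*} [Fintype W] {H : SimpleGraph V}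
    {F : SimpleGraph W} {G : SimpleGraph X} {m k : ℕ} {a b : V} (hab : H.Adj a b)
    (hm : 4 * k * (Fintype.card W + 1) < m) (g : G →g H)
    (f : F →g G.sum (SimpleGraph.circulantGraph (middleJumps m k))) : Nonempty (F →g H) := by
  classical
  -- Kept on all of `W`: vertices mapped to the left are isolated in `K`, so sending them to `0` is
  -- harmless.
  let K : SimpleGraph W :=
    { Adj := fun u v => F.Adj u v ∧ (f u).isRight ∧ (f v).isRight
      symm := ⟨fun _ _ h => ⟨h.1.symm, h.2.2, h.2.1⟩⟩
      loopless := ⟨fun _ h => F.irrefl h.1⟩ }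
  have φ : K →g SimpleGraph.circulantGraph (middleJumps m k) :=
    { toFun := fun w => Sum.elim (fun _ => 0) id (f w)
      map_rel' := by
        rintro u v ⟨huv, hu, hv⟩
        have h := f.map_adj huv
        obtain ⟨x, hx⟩ := Sum.isRight_iff.1 hu
        obtain ⟨y, hy⟩ := Sum.isRight_iff.1 hv
        rw [hx, hy] at h ⊢
        exact h }
  obtain ⟨c⟩ := colorable_two_of_hom_middleJumps hm φ
  let col : Fin 2 → V := ![a, b]
  have hcol : ∀ p q : Fin 2, p ≠ q → H.Adj (col p) (col q) := by
    intro p q hpq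
    fin_cases p <;> fin_cases q <;> simp_all [col, hab.symm]
  refine ⟨⟨fun w => Sum.elim g (fun _ => col (c w)) (f w), fun {u v} huv => ?_⟩⟩
  have h := f.map_adj huv
  rcases hu : f u with x | x <;> rcases hv : f v with y | y <;> rw [hu, hv] at h
  · exact g.map_adj h
  · simp at h
  · simp at h
  · exact hcol _ _ (c.valid ⟨huv, by simp [hu], by simp [hv]⟩)

theorem exists_pow_le_rex {V W : Type*} [Fintype V] [Nonempty V] [Fintype W]
    {H : SimpleGraph V} {F : SimpleGraph W} (hFH : IsEmpty (F →g H)) :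
    ∃ C : ℕ, 0 < C ∧ ∀ n ≥ C, (n / C) ^ Fintype.card V ≤ rex n H F := by
  classical
  by_cases hH : ∃ a b, H.Adj a b
  · obtain ⟨a, b, hab⟩ := hH
    obtain ⟨ρ⟩ := nonempty_hom_of_regularExtension hab
    let X := (V × V) ⊕ {p : V × V // ¬ H.Adj p.1 p.2}
    let D := Fintype.card V
    -- Chosen so that, with classes of size `2 * t`, the vertices left over exceed the bound needed
    -- in `colorable_two_of_hom_middleJumps`. The factor 2 makes the degree even, as the circulant
    -- graph requires.
    let C := 2 * Fintype.card X + 4 * D * (Fintype.card W + 1) + 1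
    refine ⟨C, by omega, fun n hn => ?_⟩
    let t := n / C
    have ht : 0 < t := Nat.div_pos hn (by omega)
    have hCt : C * t ≤ n := Nat.mul_div_le n C
    let m := n - Fintype.card X * (2 * t)
    have hexp : C * t = Fintype.card X * (2 * t) + 4 * (D * t) * (Fintype.card W + 1) + t := by
      simp only [C]
      ring
    have hm : 4 * (D * t) * (Fintype.card W + 1) < m := by omega
    have hk : 2 * (D * t) < m := by nlinarith
    have : NeZero m := ⟨by omega⟩
    let j : V := Classical.arbitrary V
    let φ : SimpleGraph.Copy (H.comap (Prod.fst : V × Fin t → V))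
        ((regularExtension H).comap (Prod.fst : X × Fin (2 * t) → X)) :=
      ⟨⟨fun p => (Sum.inl (p.1, j), Fin.castLE (by omega) p.2), fun h => ⟨h, rfl⟩⟩, by
        intro p q hpq
        obtain ⟨h₁, h₂⟩ := Prod.ext_iff.1 hpq
        exact Prod.ext (Prod.ext_iff.1 (Sum.inl_injective h₁)).1 (Fin.castLE_injective (by omega) h₂)⟩
    refine le_rex (U := (X × Fin (2 * t)) ⊕ ZMod m) (d := 2 * (D * t)) ?_ ?_
      (ncard_neighborSet_sum ?_ (ncard_neighborSet_middleJumps hk))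
      (SimpleGraph.Embedding.sumInl.toCopy.comp φ)
    · rw [Fintype.card_sum, Fintype.card_prod, Fintype.card_fin, ZMod.card]
      omega
    · rintro ⟨ψ⟩
      obtain ⟨h⟩ := nonempty_hom_of_sum_middleJumps hab hm
        (ρ.comp ⟨Prod.fst, fun h => h⟩) ψ.toHom
      exact hFH.elim h
    · intro x
      rw [ncard_neighborSet_comap_fst, ncard_neighborSet_regularExtension]
      ring
  -- For edgeless `H` the empty graph works: a copy of `F` in it would make `F` edgeless, and any
  -- constant map would be a homomorphism.
  · push Not at hH
    refine ⟨Fintype.card V, Fintype.card_pos, fun n hn => ?_⟩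
    obtain ⟨ι⟩ : Nonempty (V × Fin (n / Fintype.card V) ↪ Fin n) :=
      Function.Embedding.nonempty_of_card_le (by simpa using Nat.mul_div_le _ _)
    refine le_rex (U := Fin n) (G := ⊥) (d := 0) (by simp) ?_ (by simp)
      ⟨⟨ι, fun h => (hH _ _ h).elim⟩, ι.injective⟩
    rintro ⟨ψ⟩
    exact hFH.elim ⟨fun _ => Classical.arbitrary V, fun h => (ψ.toHom.map_adj h).elim⟩

end RegularTuran

theorem theorem1 {V W : Type*} [Fintype V] [Nonempty V] [Fintype W]
    (H : SimpleGraph V) (F : SimpleGraph W) :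
    ((fun n : ℕ => (RegularTuran.rex n H F : ℝ)) =Θ[atTop]
        fun n : ℕ => (n : ℝ) ^ Fintype.card V) ↔
      ¬ RegularTuran.IsSubgraphOfBlowup F H := by
  classical
  rw [RegularTuran.isSubgraphOfBlowup_iff_nonempty_hom, not_nonempty_iff]
  constructor
  · refine fun hΘ => ⟨fun h => ?_⟩
    obtain ⟨c, hc, hbound⟩ := hΘ.isBigO_symm.exists_pos
    obtain ⟨N, hN⟩ := RegularTuran.isContained_of_hom_of_many_copies h (inv_pos.2 hc)
    obtain ⟨n, hn, hn'⟩ := (hbound.bound.and (eventually_ge_atTop (max N 1))).exists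
    have hn1 : (0 : ℝ) < n := by exact_mod_cast (le_max_right N 1).trans hn'
    rw [Real.norm_of_nonneg (by positivity), Real.norm_of_nonneg (by positivity)] at hn
    -- Positivity ensures that the supremum is attained by a graph rather than being the default
    -- `0`.
    have hrex : 0 < RegularTuran.rex n H F := by
      by_contra h0
      rw [Nat.eq_zero_of_not_pos h0] at hn
      have : (0 : ℝ) < (n : ℝ) ^ Fintype.card V := by positivity
      rw [Nat.cast_zero, mul_zero] at hn
      linarith
    obtain ⟨G, hG, hle⟩ := Finset.le_sup_iff hrex |>.1 le_rfl
    refine (Finset.mem_filter.1 hG).2.1 (hN n ((le_max_left N 1).trans hn') G ?_)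
    rw [inv_mul_le_iff₀ hc]
    refine hn.trans ?_
    gcongr
  · intro hFH
    obtain ⟨C, hC, hCn⟩ := RegularTuran.exists_pow_le_rex hFH
    refine ⟨IsBigO.of_bound 1 (Eventually.of_forall fun n => ?_),
      IsBigO.of_bound ((2 * C : ℝ) ^ Fintype.card V) ?_⟩
    · rw [Real.norm_of_nonneg (by positivity), Real.norm_of_nonneg (by positivity), one_mul]
      exact_mod_cast RegularTuran.rex_le_pow n H F
    · filter_upwards [eventually_ge_atTop C] with n hn
      rw [Real.norm_of_nonneg (by positivity), Real.norm_of_nonneg (by positivity)]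
      have h1 : n ≤ 2 * C * (n / C) := by
        have := Nat.lt_mul_div_succ n hC
        have := Nat.mul_le_mul_left C (Nat.div_pos hn hC)
        nlinarith
      have h2 := (Nat.pow_le_pow_left h1 (Fintype.card V)).trans_eq (Nat.mul_pow _ _ _)
      exact_mod_cast h2.trans (Nat.mul_le_mul_left _ (hCn n hn))
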